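/- Let $(M,g)$ be a $C^r$ spacetime, $r\in\{3,4,\dots,\infty\}$, of dimension $n\ge 2$: a connected (Hausdorff, second countable) $C^r$ manifold $M$ with a Lorentzian metric $g$ of class $C^{r-1}$ and signature $(-,+,\dots,+)$, and with a time orientation. Write $I^{+}(x)$ for the set of $y\in M$ such that there is a piecewise $C^1$ future-directed timelike curve from $x$ to $y$, and put $I^{-}(y)=\{x\in M: y\in I^{+}(x)\}$. Let $J^{+}\subset M\times M$ be the set of pairs $(x,y)$ such that $x=y$ or there is a piecewise $C^1$ future-directed causal curve from $x$ to $y$. Put $$A^{+}=\overline{J^{+}}\subset M\times M,\qquad D^{+}_f=\{(x,y): y\in\overline{I^{+}(x)}\},\qquad D^{+}_p=\{(x,y): x\in\overline{I^{-}(y)}\},\qquad D^{+}=D^{+}_p\cap D^{+}_f .$$ The spacetime is called future reflecting if for all $x,y\in M$ the inclusion $I^{-}(x)\subset I^{-}(y)$ implies $I^{+}(y)\subset I^{+}(x)$, past reflecting if for all $x,y\in M$ the inclusion $I^{+}(y)\subset I^{+}(x)$ implies $I^{-}(x)\subset I^{-}(y)$, and reflecting if it is both future and past reflecting. Then $(M,g)$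 is reflecting if and only if $D^{+}=A^{+}$. -/

import Mathlib

open Set
open scoped Manifold Topology ContDiff Bundle

noncomputable section

namespace Spacetime

/-- A Lorentzian metric of signature `(-,+,…,+)` on an `n`-dimensional manifold of class `C^r`.
As a tensor field on a `C^r` manifold, it is of class `C^(r-1)`. -/
structure LorentzianMetric (n : ℕ) (r : ℕ∞) (M : Type*) [TopologicalSpace M]
    [ChartedSpace (EuclideanSpace ℝ (Fin n)) M] [IsManifold (𝓡 n) 1 M] where
  /-- The bilinear form on each tangent space. -/
  form (x : M) : TangentSpace (𝓡 n) x →L[ℝ] TangentSpace (𝓡 n) x →L[ℝ] ℝ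
  symm (x : M) (v w : TangentSpace (𝓡 n) x) : form x v w = form x w v
  /-- Every tangent space has an orthonormal basis with exactly one (the first) negative vector. -/
  signature (x : M) : ∃ b : Module.Basis (Fin n) ℝ (TangentSpace (𝓡 n) x),
    ∀ i j, form x (b i) (b j) = if i = j then (if (i : ℕ) = 0 then -1 else 1) else 0
  contMDiff : ContMDiff (𝓡 n)
    ((𝓡 n).prod 𝓘(ℝ, EuclideanSpace ℝ (Fin n) →L[ℝ] EuclideanSpace ℝ (Fin n) →L[ℝ] ℝ))
    ((r - 1 : ℕ∞) : WithTop ℕ∞)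
    (fun x ↦ Bundle.TotalSpace.mk'
      (EuclideanSpace ℝ (Fin n) →L[ℝ] EuclideanSpace ℝ (Fin n) →L[ℝ] ℝ)
      (E := fun x : M ↦ TangentSpace (𝓡 n) x →L[ℝ] TangentSpace (𝓡 n) x →L[ℝ] ℝ) x (form x))

variable {n : ℕ} {r : ℕ∞} {M : Type*} [TopologicalSpace M]
  [ChartedSpace (EuclideanSpace ℝ (Fin n)) M] [IsManifold (𝓡 n) 1 M]

/-- A time orientation, given by a continuous timelike vector field declared to be
future-directed. -/
structure TimeOrientation (g : LorentzianMetric n r M) where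
  /-- The future-directed timelike vector field. -/
  field (x : M) : TangentSpace (𝓡 n) x
  continuous : Continuous (fun x ↦ (⟨x, field x⟩ : TangentBundle (𝓡 n) M))
  timelike (x : M) : g.form x (field x) (field x) < 0

variable {g : LorentzianMetric n r M} (τ : TimeOrientation g)

namespace TimeOrientation

/-- Future-directed timelike tangent vectors. -/
def IsFutureTimelike (x : M) (v : TangentSpace (𝓡 n) x) : Prop :=
  g.form x v v < 0 ∧ g.form x (τ.field x) v < 0

/-- Future-directed causal tangent vectors; they are timelike or null, and nonzero since
`g (τ.field x) v < 0`. -/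
def IsFutureCausal (x : M) (v : TangentSpace (𝓡 n) x) : Prop :=
  g.form x v v ≤ 0 ∧ g.form x (τ.field x) v < 0

/-- `γ` restricted to `[a, b]` is a `C^1` curve all of whose velocities (one-sided at the end
points) are future-directed timelike. -/
def IsTimelikeArc (γ : ℝ → M) (a b : ℝ) : Prop :=
  ContMDiffOn 𝓘(ℝ, ℝ) (𝓡 n) 1 γ (Icc a b) ∧
    ∀ t ∈ Icc a b, τ.IsFutureTimelike (γ t)
      (mfderivWithin 𝓘(ℝ, ℝ) (𝓡 n) γ (Icc a b) t (1 : ℝ))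

/-- `γ` restricted to `[a, b]` is a `C^1` curve all of whose velocities (one-sided at the end
points) are future-directed causal. -/
def IsCausalArc (γ : ℝ → M) (a b : ℝ) : Prop :=
  ContMDiffOn 𝓘(ℝ, ℝ) (𝓡 n) 1 γ (Icc a b) ∧
    ∀ t ∈ Icc a b, τ.IsFutureCausal (γ t)
      (mfderivWithin 𝓘(ℝ, ℝ) (𝓡 n) γ (Icc a b) t (1 : ℝ))

/-- `x ≪ y`: there is a piecewise `C^1` future-directed timelike curve from `x` to `y`, that is, a
concatenation of a positive finite number of `C^1` future-directed timelike arcs. -/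
def Chron : M → M → Prop :=
  Relation.TransGen fun x y ↦ ∃ (γ : ℝ → M) (a b : ℝ),
    a < b ∧ τ.IsTimelikeArc γ a b ∧ γ a = x ∧ γ b = y

/-- `x ≤ y`: either `x = y` or there is a piecewise `C^1` future-directed causal curve from `x` to
`y`, that is, a concatenation of finitely many `C^1` future-directed causal arcs. -/
def Causal : M → M → Prop :=
  Relation.ReflTransGen fun x y ↦ ∃ (γ : ℝ → M) (a b : ℝ),
    a < b ∧ τ.IsCausalArc γ a b ∧ γ a = x ∧ γ b = y

/-- The chronological future `I⁺(x)`. -/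
def chronFuture (x : M) : Set M := {y | τ.Chron x y}

/-- The chronological past `I⁻(x)`. -/
def chronPast (x : M) : Set M := {y | τ.Chron y x}

/-- The causal relation `J⁺ ⊆ M × M`. -/
def J : Set (M × M) := {p | τ.Causal p.1 p.2}

/-- `A⁺`, the closure of `J⁺` in `M × M`. -/
def A : Set (M × M) := closure τ.J

/-- `D⁺_f = {(x, y) | y ∈ closure I⁺(x)}`. -/
def Df : Set (M × M) := {p | p.2 ∈ closure (τ.chronFuture p.1)}

/-- `D⁺_p = {(x, y) | x ∈ closure I⁻(y)}`. -/
def Dp : Set (M × M) := {p | p.1 ∈ closure (τ.chronPast p.2)}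

/-- `D⁺ = D⁺_p ∩ D⁺_f`. -/
def D : Set (M × M) := τ.Dp ∩ τ.Df

/-- Future reflectivity: `I⁻(x) ⊆ I⁻(y)` implies `I⁺(y) ⊆ I⁺(x)`. -/
def IsFutureReflecting : Prop :=
  ∀ x y : M, τ.chronPast x ⊆ τ.chronPast y → τ.chronFuture y ⊆ τ.chronFuture x

/-- Past reflectivity: `I⁺(y) ⊆ I⁺(x)` implies `I⁻(x) ⊆ I⁻(y)`. -/
def IsPastReflecting : Prop :=
  ∀ x y : M, τ.chronFuture y ⊆ τ.chronFuture x → τ.chronPast x ⊆ τ.chronPast y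

/-- A spacetime is reflecting if it is both future and past reflecting. -/
def IsReflecting : Prop := τ.IsFutureReflecting ∧ τ.IsPastReflecting

end TimeOrientation

end Spacetime

end

namespace Spacetime

/-! Since `I⁺` and `I⁻` are open and every point lies in the closure of its own future and past, `y
∈ closure I⁺(x)` iff `I⁺(y) ⊆ I⁺(x)`, and dually. Hence future reflectivity says `Dp ⊆ Df` and past
reflectivity says `Df ⊆ Dp`. Both `Df` and `Dp` always lie in `A`, so `D = A` forces both
inclusions. Conversely, let `(x, y) ∈ A`. If `z ≪ x` and `y ≪ w` then `z ≪ w` (`chron_of_mem_A`), so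
future reflectivity puts `w` in `closure I⁺(x)`; letting `w → y` gives `(x, y) ∈ Df`, and past
reflectivity gives `Dp`. The analytic input is that `x ≤ y` implies `I⁺(y) ⊆ I⁺(x)`. It is proved
without geodesics: tilting a causal curve slightly along the time orientation in a chart makes it
timelike near its start (`eventually_timelike_perturbation`), and continuous induction covers the
whole arc. -/

/-! ### Timelike perturbations in a normed space -/

theorem exists_Icc_right_of_eventually {P : ℝ → Prop} {a b u : ℝ} (hab : a < b) (hu : a < u)
    (h : ∀ᶠ t in 𝓝[Icc a b] a, P t) : ∃ t₁ ∈ Ioc a b, t₁ ≤ u ∧ ∀ t ∈ Icc a t₁, P t := by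
  rw [nhdsWithin_Icc_eq_nhdsGE hab] at h
  obtain ⟨s, hs, hsP⟩ := mem_nhdsGE_iff_exists_Icc_subset.1 h
  refine ⟨min s (min b u), ⟨lt_min hs (lt_min hab hu), by simp⟩, by simp, fun t ht ↦ hsP ?_⟩
  exact ⟨ht.1, ht.2.trans (min_le_left _ _)⟩

theorem exists_Icc_left_of_eventually {P : ℝ → Prop} {a b : ℝ} (hab : a < b)
    (h : ∀ᶠ t in 𝓝[Icc a b] b, P t) : ∃ t₁ ∈ Ico a b, ∀ t ∈ Icc t₁ b, P t := by
  rw [nhdsWithin_Icc_eq_nhdsLE hab] at h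
  obtain ⟨s, hs, hsP⟩ := mem_nhdsLE_iff_exists_Icc_subset.1 h
  refine ⟨max s a, ⟨by simp, max_lt hs hab⟩, fun t ht ↦ hsP ?_⟩
  exact ⟨(le_max_left _ _).trans ht.1, ht.2⟩

/-- The future-directed timelike condition is open. -/
theorem exists_ball_timelike {E : Type*} [NormedAddCommGroup E] [NormedSpace ℝ E]
    {G : E → E →L[ℝ] E →L[ℝ] ℝ} {θ : E → E} {z v : E} {O : Set E} (hO : O ∈ 𝓝 z)
    (hG : ContinuousAt G z) (hθ : ContinuousAt θ z) (hv : G z v v < 0 ∧ G z (θ z) v < 0) :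
    ∃ ρ > 0, ∀ x ∈ Metric.ball z ρ, ∀ w ∈ Metric.ball v ρ,
      x ∈ O ∧ G x w w < 0 ∧ G x (θ x) w < 0 := by
  have hfst : ContinuousAt (fun q : E × E ↦ q.1) (z, v) := continuousAt_fst
  have hG1 := ContinuousAt.comp (g := G) (x := (z, v)) hG hfst
  have hθ1 := ContinuousAt.comp (g := θ) (x := (z, v)) hθ hfst
  have e1 := ((hG1.clm_apply continuousAt_snd).clm_apply continuousAt_snd).eventually_lt_const hv.1
  have e2 := ((hG1.clm_apply hθ1).clm_apply continuousAt_snd).eventually_lt_const hv.2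
  obtain ⟨ρ, hρ, hball⟩ := Metric.eventually_nhds_iff_ball.1
    ((hfst.eventually hO).and (e1.and e2))
  refine ⟨ρ, hρ, fun x hx w hw ↦ hball (x, w) ?_⟩
  rw [← ball_prod_same]
  exact ⟨hx, hw⟩

set_option synthInstance.maxHeartbeats 200000 in
/-- Moving a causal curve along a timelike vector at a rate `ε` makes it timelike near its initial
point. -/
theorem eventually_timelike_perturbation {E : Type*} [NormedAddCommGroup E] [NormedSpace ℝ E]
    {G : E → E →L[ℝ] E →L[ℝ] ℝ} {θ : E → E} {c c' : ℝ → E} {a b u : ℝ} (hab : a < b) (hu : a < u)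
    {O : Set E} (hO : O ∈ 𝓝 (c a))
    (hG : ContDiffAt ℝ 1 G (c a)) (hθ : ContinuousAt θ (c a))
    (hsymm : ∀ z ∈ O, ∀ v w, G z v w = G z w v)
    (hc : ContinuousWithinAt c (Icc a b) a) (hc' : ContinuousWithinAt c' (Icc a b) a)
    (hcausal : ∀ t ∈ Icc a b, G (c t) (c' t) (c' t) ≤ 0)
    (hfuture : G (c a) (θ (c a)) (c' a) < 0) (htime : G (c a) (θ (c a)) (θ (c a)) < 0) :
    ∃ t₁ ∈ Ioc a b, t₁ ≤ u ∧ ∀ᶠ ε in 𝓝[>] (0 : ℝ), ∀ t ∈ Icc a t₁,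
      c t + (ε * (t - a)) • θ (c a) ∈ O ∧
      G (c t + (ε * (t - a)) • θ (c a)) (c' t + ε • θ (c a)) (c' t + ε • θ (c a)) < 0 ∧
      G (c t + (ε * (t - a)) • θ (c a)) (θ (c t + (ε * (t - a)) • θ (c a)))
        (c' t + ε • θ (c a)) < 0 := by
  -- The tilt changes the quadratic form by `2εG(T, c') < -2κε` to first order, while moving the
  -- base point costs at most a Lipschitz error `ε · O(t - a)`. Both are linear in `ε`, so `t₁` can
  -- be fixed before `ε`.
  obtain ⟨κ, hκ, hκ'⟩ : ∃ κ > 0, G (c a) (θ (c a)) (c' a) < -κ :=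
    ⟨-G (c a) (θ (c a)) (c' a) / 2, by linarith, by linarith⟩
  obtain ⟨K, S, hS, hK⟩ := hG.exists_lipschitzOnWith
  set T := θ (c a)
  have hfst : ContinuousAt (fun q : E × E ↦ q.1) (c a, c' a) := continuousAt_fst
  have hG1 : ContinuousAt (fun q : E × E ↦ G q.1) (c a, c' a) :=
    ContinuousAt.comp (g := G) hG.continuousAt hfst
  have hθ1 : ContinuousAt (fun q : E × E ↦ θ q.1) (c a, c' a) :=
    ContinuousAt.comp (g := θ) hθ hfst
  have e1 := ((hG1.clm_apply (continuousAt_const (y := T))).clm_apply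
    continuousAt_snd).eventually_lt_const hκ'
  have e2 := ((hG1.clm_apply hθ1).clm_apply continuousAt_snd).eventually_lt_const hfuture
  have e3 := ((hG1.clm_apply (continuousAt_const (y := T))).clm_apply
    (continuousAt_const (y := T))).eventually_lt_const htime
  obtain ⟨ρ, hρ, hball⟩ := Metric.eventually_nhds_iff_ball.1
    (((e1.and e2).and e3).and (hfst.eventually (Filter.inter_mem hO hS)))
  have hball' : ∀ z v, ‖z - c a‖ < ρ → ‖v - c' a‖ < ρ → G z T v < -κ ∧ G z (θ z) v < 0 ∧
      G z T T < 0 ∧ z ∈ O ∧ z ∈ S := by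
    intro z v hz hv
    have := hball (z, v) (by
      rw [Metric.mem_ball, Prod.dist_eq]
      exact max_lt (by rwa [dist_eq_norm]) (by rwa [dist_eq_norm]))
    exact ⟨this.1.1.1, this.1.1.2, this.1.2, this.2.1, this.2.2⟩
  have hd : Filter.Tendsto (fun t : ℝ ↦ K * (t - a) * ‖T‖ * (‖c' a‖ + ρ) ^ 2)
      (𝓝[Icc a b] a) (𝓝 0) := by
    have : Continuous (fun t : ℝ ↦ K * (t - a) * ‖T‖ * (‖c' a‖ + ρ) ^ 2) := by fun_prop
    simpa using (this.tendsto a).mono_left nhdsWithin_le_nhds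
  -- This makes `ε(t - a) ≤ ε`, so a single smallness condition on `ε` controls both the
  -- displacement and the tilt.
  have hd1 : ∀ᶠ t in 𝓝[Icc a b] a, t < a + 1 :=
    nhdsWithin_le_nhds (eventually_lt_nhds (by linarith))
  have f1 := hc.eventually (Metric.ball_mem_nhds _ (half_pos hρ))
  have f2 := hc'.eventually (Metric.ball_mem_nhds _ (half_pos hρ))
  obtain ⟨t₁, ht₁, htu, hP⟩ := exists_Icc_right_of_eventually hab hu
    (((f1.and f2).and hd1).and (hd.eventually_lt_const (show (0 : ℝ) < 2 * κ by linarith)))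
  refine ⟨t₁, ht₁, htu, ?_⟩
  have g1 : ∀ᶠ ε in 𝓝[>] (0 : ℝ), ε * ‖T‖ < ρ / 2 := by
    have : Filter.Tendsto (fun ε : ℝ ↦ ε * ‖T‖) (𝓝[>] 0) (𝓝 0) := by
      have h : Continuous (fun ε : ℝ ↦ ε * ‖T‖) := by fun_prop
      simpa using (h.tendsto 0).mono_left nhdsWithin_le_nhds
    exact this.eventually_lt_const (half_pos hρ)
  filter_upwards [g1, self_mem_nhdsWithin] with ε hε hε0 t ht
  rw [mem_Ioi] at hε0
  obtain ⟨⟨⟨hct, hct'⟩, ht1⟩, hKt⟩ := hP t ht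
  rw [dist_eq_norm] at hct hct'
  have hta : 0 ≤ t - a := by linarith [ht.1]
  have hshift : ‖(ε * (t - a)) • T‖ = ε * (t - a) * ‖T‖ := by
    rw [norm_smul, Real.norm_of_nonneg (by positivity)]
  have hshift' : ε * (t - a) * ‖T‖ < ρ / 2 := by
    refine lt_of_le_of_lt ?_ hε
    have : ε * (t - a) ≤ ε := by nlinarith
    gcongr
  set η := c t + (ε * (t - a)) • T with hη
  have hη1 : ‖η - c a‖ < ρ := by
    have : η - c a = (c t - c a) + (ε * (t - a)) • T := by rw [hη]; abel
    rw [this]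
    linarith [norm_add_le (c t - c a) ((ε * (t - a)) • T)]
  have hv1 : ‖(c' t + ε • T) - c' a‖ < ρ := by
    have : (c' t + ε • T) - c' a = (c' t - c' a) + ε • T := by abel
    rw [this]
    have h2 : ‖ε • T‖ = ε * ‖T‖ := by rw [norm_smul, Real.norm_of_nonneg hε0.le]
    linarith [norm_add_le (c' t - c' a) (ε • T)]
  obtain ⟨-, q2, q3, q4, q5⟩ := hball' η _ hη1 hv1
  obtain ⟨r1, -, -, -, -⟩ := hball' η (c' t) hη1 (by linarith)
  obtain ⟨-, -, -, -, r5⟩ := hball' (c t) (c' t) (by linarith) (by linarith)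
  refine ⟨q4, ?_, q2⟩
  have hlip : ‖G η - G (c t)‖ ≤ K * (ε * (t - a) * ‖T‖) := by
    have := hK.dist_le_mul _ q5 _ r5
    rwa [dist_eq_norm, dist_eq_norm η, add_sub_cancel_left, hshift] at this
  have hcn : ‖c' t‖ ≤ ‖c' a‖ + ρ := by
    have := norm_add_le (c' t - c' a) (c' a)
    rw [sub_add_cancel] at this
    linarith
  have hdiff : G η (c' t) (c' t) ≤ ε * (K * (t - a) * ‖T‖ * (‖c' a‖ + ρ) ^ 2) := by
    have h1 : (G η - G (c t)) (c' t) (c' t) ≤ ‖G η - G (c t)‖ * ‖c' t‖ * ‖c' t‖ :=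
      (le_abs_self _).trans ((G η - G (c t)).le_opNorm₂ _ _)
    have h2 : ‖G η - G (c t)‖ * ‖c' t‖ * ‖c' t‖ ≤
        K * (ε * (t - a) * ‖T‖) * (‖c' a‖ + ρ) * (‖c' a‖ + ρ) := by gcongr
    have h3 := hcausal t ⟨ht.1, ht.2.trans ht₁.2⟩
    simp only [sub_apply] at h1
    linarith
  have hexp : G η (c' t + ε • T) (c' t + ε • T) =
      G η (c' t) (c' t) + 2 * ε * G η T (c' t) + ε ^ 2 * G η T T := by
    simp only [map_add, map_smul, add_apply, smul_apply,
      smul_eq_mul, hsymm η q4 (c' t) T]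
    ring
  rw [hexp]
  have h4 : ε * (K * (t - a) * ‖T‖ * (‖c' a‖ + ρ) ^ 2) < ε * (2 * κ) := by gcongr
  have h5 : ε * G η T (c' t) < ε * (-κ) := by gcongr
  have h6 : ε ^ 2 * G η T T < 0 := mul_neg_of_pos_of_neg (by positivity) q3
  linarith

/-! ### The metric, the time orientation and velocities in a chart -/

theorem mfderivWithin_Icc_subset {n : ℕ} {M : Type*} [TopologicalSpace M]
    [ChartedSpace (EuclideanSpace ℝ (Fin n)) M] {γ : ℝ → M} {a b a' b' : ℝ}
    (h : ContMDiffOn 𝓘(ℝ, ℝ) (𝓡 n) 1 γ (Icc a b)) (ha : a ≤ a') (hab : a' < b') (hb : b' ≤ b)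
    {t : ℝ} (ht : t ∈ Icc a' b') :
    mfderivWithin 𝓘(ℝ, ℝ) (𝓡 n) γ (Icc a' b') t = mfderivWithin 𝓘(ℝ, ℝ) (𝓡 n) γ (Icc a b) t :=
  mfderivWithin_subset (Icc_subset_Icc ha hb) ((uniqueDiffOn_Icc hab t ht).uniqueMDiffWithinAt)
    ((h.mdifferentiableOn one_ne_zero) t (Icc_subset_Icc ha hb ht))

variable {n : ℕ} {r : ℕ∞} {M : Type*} [TopologicalSpace M]
  [ChartedSpace (EuclideanSpace ℝ (Fin n)) M] [IsManifold (𝓡 n) 1 M]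

/-- The derivative of the inverse of the chart at `p`, at the point `z` of the chart. -/
noncomputable def chartPush (n : ℕ) {M : Type*} [TopologicalSpace M]
    [ChartedSpace (EuclideanSpace ℝ (Fin n)) M] (p : M) (z : EuclideanSpace ℝ (Fin n)) :
    EuclideanSpace ℝ (Fin n) →L[ℝ] TangentSpace (𝓡 n) ((extChartAt (𝓡 n) p).symm z) :=
  mfderivWithin 𝓘(ℝ, EuclideanSpace ℝ (Fin n)) (𝓡 n) (extChartAt (𝓡 n) p).symm (range (𝓡 n)) z

/-- The metric in the chart at `p`. -/
noncomputable def LorentzianMetric.chartForm (g : LorentzianMetric n r M) (p : M)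
    (z : EuclideanSpace ℝ (Fin n)) :
    EuclideanSpace ℝ (Fin n) →L[ℝ] EuclideanSpace ℝ (Fin n) →L[ℝ] ℝ :=
  ContinuousLinearMap.inCoordinates (EuclideanSpace ℝ (Fin n)) (TangentSpace (𝓡 n) (M := M))
    (EuclideanSpace ℝ (Fin n) →L[ℝ] ℝ) (fun x : M ↦ TangentSpace (𝓡 n) x →L[ℝ] ℝ)
    p ((extChartAt (𝓡 n) p).symm z) p ((extChartAt (𝓡 n) p).symm z)
    (g.form ((extChartAt (𝓡 n) p).symm z))

/-- The time orientation in the chart at `p`. -/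
noncomputable def TimeOrientation.chartField {g : LorentzianMetric n r M} (τ : TimeOrientation g)
    (p : M) (z : EuclideanSpace ℝ (Fin n)) : EuclideanSpace ℝ (Fin n) :=
  (trivializationAt (EuclideanSpace ℝ (Fin n)) (TangentSpace (𝓡 n) (M := M)) p
    ⟨(extChartAt (𝓡 n) p).symm z, τ.field ((extChartAt (𝓡 n) p).symm z)⟩).2

/-- Links the bundle trivialization, where regularity is known, to the derivative of the inverse
chart, which transports velocities. -/
theorem symmL_eq_chartPush {p : M} {z : EuclideanSpace ℝ (Fin n)}
    (hz : z ∈ (extChartAt (𝓡 n) p).target) :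
    (trivializationAt (EuclideanSpace ℝ (Fin n)) (TangentSpace (𝓡 n) (M := M)) p).symmL ℝ
      ((extChartAt (𝓡 n) p).symm z) = chartPush n p z := by
  have h := (extChartAt (𝓡 n) p).map_target hz
  rw [extChartAt_source] at h
  rw [TangentBundle.symmL_trivializationAt h, (extChartAt (𝓡 n) p).right_inv hz]
  rfl

theorem LorentzianMetric.chartForm_apply (g : LorentzianMetric n r M) {p : M}
    {z : EuclideanSpace ℝ (Fin n)} (hz : z ∈ (extChartAt (𝓡 n) p).target)
    (v w : EuclideanSpace ℝ (Fin n)) :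
    g.chartForm p z v w =
      g.form ((extChartAt (𝓡 n) p).symm z) (chartPush n p z v) (chartPush n p z w) := by
  have h := (extChartAt (𝓡 n) p).map_target hz
  rw [extChartAt_source] at h
  rw [chartForm, inCoordinates_apply_eq₂ (F₃ := ℝ) (E₃ := Bundle.Trivial M ℝ) h h (by simp),
    ← symmL_eq_chartPush hz, Bundle.Trivialization.symmL_apply _ h,
    Bundle.Trivialization.symmL_apply _ h]
  simp

theorem TimeOrientation.chartPush_chartField {g : LorentzianMetric n r M} (τ : TimeOrientation g)
    {p : M} {z : EuclideanSpace ℝ (Fin n)} (hz : z ∈ (extChartAt (𝓡 n) p).target) :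
    chartPush n p z (τ.chartField p z) = τ.field ((extChartAt (𝓡 n) p).symm z) := by
  have h := (extChartAt (𝓡 n) p).map_target hz
  rw [extChartAt_source] at h
  rw [← symmL_eq_chartPush hz, chartField]
  rw [Bundle.Trivialization.symmL_apply _ h]
  exact Bundle.Trivialization.symm_apply_apply_mk _ h _

/-- The bound `2 ≤ r` enters here: it makes the metric `C^1`, hence locally Lipschitz in the chart,
as the perturbation estimate requires. -/
theorem LorentzianMetric.contDiffAt_chartForm (g : LorentzianMetric n r M) (hr : 2 ≤ r) (p : M) :
    ContDiffAt ℝ 1 (g.chartForm p) (extChartAt (𝓡 n) p p) := by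
  have h := (g.contMDiff p).of_le (m := 1) (by
    have : (1 : ℕ∞) ≤ r - 1 := by
      induction r with
      | top => exact le_top
      | coe m => exact_mod_cast (by have : 2 ≤ m := by exact_mod_cast hr
                                    omega)
    exact_mod_cast this)
  have h2 := ((contMDiffAt_hom_bundle _).1 h).2
  rw [← contMDiffAt_iff_contDiffAt]
  refine ContMDiffAt.comp _ (g := fun x : M ↦ ContinuousLinearMap.inCoordinates
    (EuclideanSpace ℝ (Fin n)) (TangentSpace (𝓡 n) (M := M)) (EuclideanSpace ℝ (Fin n) →L[ℝ] ℝ)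
    (fun x : M ↦ TangentSpace (𝓡 n) x →L[ℝ] ℝ) p x p x (g.form x)) (I' := 𝓡 n)
    (f := (extChartAt (𝓡 n) p).symm) ?_ ?_
  · rw [(extChartAt (𝓡 n) p).left_inv (mem_extChartAt_source p)]
    exact h2
  · exact (contMDiffOn_extChartAt_symm p).contMDiffAt (extChartAt_target_mem_nhds p)

theorem TimeOrientation.continuousAt_chartField {g : LorentzianMetric n r M}
    (τ : TimeOrientation g) (p : M) :
    ContinuousAt (τ.chartField p) (extChartAt (𝓡 n) p p) := by
  have h := ((FiberBundle.continuousAt_totalSpace _ _).1 (τ.continuous.continuousAt (x := p))).2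
  refine ContinuousAt.comp (g := fun x : M ↦
    (trivializationAt (EuclideanSpace ℝ (Fin n)) (TangentSpace (𝓡 n) (M := M)) p ⟨x, τ.field x⟩).2)
    (f := (extChartAt (𝓡 n) p).symm) ?_ (continuousAt_extChartAt_symm p)
  rw [(extChartAt (𝓡 n) p).left_inv (mem_extChartAt_source p)]
  exact h

theorem isFutureTimelike_chartPush_iff {g : LorentzianMetric n r M} (τ : TimeOrientation g)
    {p : M} {z : EuclideanSpace ℝ (Fin n)} (hz : z ∈ (extChartAt (𝓡 n) p).target)
    (v : EuclideanSpace ℝ (Fin n)) :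
    τ.IsFutureTimelike ((extChartAt (𝓡 n) p).symm z) (chartPush n p z v) ↔
      g.chartForm p z v v < 0 ∧ g.chartForm p z (τ.chartField p z) v < 0 := by
  rw [g.chartForm_apply hz, g.chartForm_apply hz, τ.chartPush_chartField hz]
  rfl

theorem isFutureCausal_chartPush_iff {g : LorentzianMetric n r M} (τ : TimeOrientation g)
    {p : M} {z : EuclideanSpace ℝ (Fin n)} (hz : z ∈ (extChartAt (𝓡 n) p).target)
    (v : EuclideanSpace ℝ (Fin n)) :
    τ.IsFutureCausal ((extChartAt (𝓡 n) p).symm z) (chartPush n p z v) ↔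
      g.chartForm p z v v ≤ 0 ∧ g.chartForm p z (τ.chartField p z) v < 0 := by
  rw [g.chartForm_apply hz, g.chartForm_apply hz, τ.chartPush_chartField hz]
  rfl

theorem mfderivWithin_extChartAt_symm_comp {p : M} {c : ℝ → EuclideanSpace ℝ (Fin n)}
    {s : Set ℝ} (hs : UniqueDiffOn ℝ s) (hc : DifferentiableOn ℝ c s)
    (hmem : MapsTo c s (extChartAt (𝓡 n) p).target) {t : ℝ} (ht : t ∈ s) :
    mfderivWithin 𝓘(ℝ, ℝ) (𝓡 n) ((extChartAt (𝓡 n) p).symm ∘ c) s t (1 : ℝ) =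
      chartPush n p (c t) (derivWithin c s t) := by
  have h := mfderivWithin_comp (I := 𝓘(ℝ, ℝ)) (I' := 𝓘(ℝ, EuclideanSpace ℝ (Fin n))) (I'' := 𝓡 n)
    (g := (extChartAt (𝓡 n) p).symm) (f := c) (s := s) (u := range (𝓡 n)) t
    (mdifferentiableWithinAt_extChartAt_symm (hmem ht))
    (hc.mdifferentiableOn t ht) (by simp) ((hs t ht).uniqueMDiffWithinAt)
  rw [h, mfderivWithin_eq_fderivWithin, ← fderivWithin_derivWithin]
  rfl

variable {g : LorentzianMetric n r M} (τ : TimeOrientation g)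

namespace TimeOrientation

variable {τ}

/-! ### Timelike and causal arcs in a chart -/

theorem IsTimelikeArc.mono {γ : ℝ → M} {a b a' b' : ℝ} (h : τ.IsTimelikeArc γ a b) (ha : a ≤ a')
    (hab : a' < b') (hb : b' ≤ b) : τ.IsTimelikeArc γ a' b' := by
  refine ⟨h.1.mono (Icc_subset_Icc ha hb), fun t ht ↦ ?_⟩
  rw [mfderivWithin_Icc_subset h.1 ha hab hb ht]
  exact h.2 t (Icc_subset_Icc ha hb ht)

theorem IsCausalArc.mono {γ : ℝ → M} {a b a' b' : ℝ} (h : τ.IsCausalArc γ a b) (ha : a ≤ a')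
    (hab : a' < b') (hb : b' ≤ b) : τ.IsCausalArc γ a' b' := by
  refine ⟨h.1.mono (Icc_subset_Icc ha hb), fun t ht ↦ ?_⟩
  rw [mfderivWithin_Icc_subset h.1 ha hab hb ht]
  exact h.2 t (Icc_subset_Icc ha hb ht)

theorem IsTimelikeArc.isCausalArc {γ : ℝ → M} {a b : ℝ} (h : τ.IsTimelikeArc γ a b) :
    τ.IsCausalArc γ a b :=
  ⟨h.1, fun t ht ↦ ⟨(h.2 t ht).1.le, (h.2 t ht).2⟩⟩

theorem contDiffOn_extChartAt_comp {γ : ℝ → M} {s : Set ℝ} {p : M}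
    (h : ContMDiffOn 𝓘(ℝ, ℝ) (𝓡 n) 1 γ s) (hs : MapsTo γ s (extChartAt (𝓡 n) p).source) :
    ContDiffOn ℝ 1 (extChartAt (𝓡 n) p ∘ γ) s := by
  rw [← contMDiffOn_iff_contDiffOn]
  rw [extChartAt_source] at hs
  exact (contMDiffOn_extChartAt (x := p)).comp h hs

/-- The velocity of a curve is the push-forward of its velocity in a chart. -/
theorem mfderivWithin_eq_chartPush {γ : ℝ → M} {s : Set ℝ} {p : M} (hs : UniqueDiffOn ℝ s)
    (h : ContMDiffOn 𝓘(ℝ, ℝ) (𝓡 n) 1 γ s) (hm : MapsTo γ s (extChartAt (𝓡 n) p).source) {t : ℝ}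
    (ht : t ∈ s) (Q : ∀ x : M, TangentSpace (𝓡 n) x → Prop) :
    Q (γ t) (mfderivWithin 𝓘(ℝ, ℝ) (𝓡 n) γ s t (1 : ℝ)) ↔
      Q ((extChartAt (𝓡 n) p).symm (extChartAt (𝓡 n) p (γ t)))
        (chartPush n p (extChartAt (𝓡 n) p (γ t))
          (derivWithin (extChartAt (𝓡 n) p ∘ γ) s t)) := by
  have hc := contDiffOn_extChartAt_comp h hm
  have key := mfderivWithin_extChartAt_symm_comp hs (hc.differentiableOn one_ne_zero)
    (fun u hu ↦ (extChartAt (𝓡 n) p).map_source (hm hu)) ht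
  have hcongr : ∀ u ∈ s, ((extChartAt (𝓡 n) p).symm ∘ (extChartAt (𝓡 n) p ∘ γ)) u = γ u :=
    fun u hu ↦ (extChartAt (𝓡 n) p).left_inv (hm hu)
  have hd := mfderivWithin_congr (I := 𝓘(ℝ, ℝ)) (I' := 𝓡 n) hcongr (hcongr t ht)
  -- All tangent spaces are definitionally the model space, so a vector can be kept while its base
  -- point is rewritten.
  have hQ : ∀ (x y : M) (hxy : x = y) (v : EuclideanSpace ℝ (Fin n)), Q x v ↔ Q y v := by
    rintro x y rfl v
    rfl
  simp only [Function.comp_apply] at key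
  rw [← key]
  refine (hQ _ _ (hcongr t ht).symm _).trans (iff_of_eq ?_)
  exact congrArg (fun L : ℝ →L[ℝ] EuclideanSpace ℝ (Fin n) ↦
    Q ((extChartAt (𝓡 n) p).symm (extChartAt (𝓡 n) p (γ t))) (L 1)) hd.symm

theorem IsCausalArc.chart {γ : ℝ → M} {a b : ℝ} {p : M} (hab : a < b) (h : τ.IsCausalArc γ a b)
    (hm : MapsTo γ (Icc a b) (extChartAt (𝓡 n) p).source) {t : ℝ} (ht : t ∈ Icc a b) :
    g.chartForm p (extChartAt (𝓡 n) p (γ t))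
        (derivWithin (extChartAt (𝓡 n) p ∘ γ) (Icc a b) t)
        (derivWithin (extChartAt (𝓡 n) p ∘ γ) (Icc a b) t) ≤ 0 ∧
      g.chartForm p (extChartAt (𝓡 n) p (γ t)) (τ.chartField p (extChartAt (𝓡 n) p (γ t)))
        (derivWithin (extChartAt (𝓡 n) p ∘ γ) (Icc a b) t) < 0 :=
  (isFutureCausal_chartPush_iff τ ((extChartAt (𝓡 n) p).map_source (hm ht)) _).1
    ((mfderivWithin_eq_chartPush (uniqueDiffOn_Icc hab) h.1 hm ht τ.IsFutureCausal).1 (h.2 t ht))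

theorem IsTimelikeArc.chart {γ : ℝ → M} {a b : ℝ} {p : M} (hab : a < b)
    (h : τ.IsTimelikeArc γ a b)
    (hm : MapsTo γ (Icc a b) (extChartAt (𝓡 n) p).source) {t : ℝ} (ht : t ∈ Icc a b) :
    g.chartForm p (extChartAt (𝓡 n) p (γ t))
        (derivWithin (extChartAt (𝓡 n) p ∘ γ) (Icc a b) t)
        (derivWithin (extChartAt (𝓡 n) p ∘ γ) (Icc a b) t) < 0 ∧
      g.chartForm p (extChartAt (𝓡 n) p (γ t)) (τ.chartField p (extChartAt (𝓡 n) p (γ t)))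
        (derivWithin (extChartAt (𝓡 n) p ∘ γ) (Icc a b) t) < 0 :=
  (isFutureTimelike_chartPush_iff τ ((extChartAt (𝓡 n) p).map_source (hm ht)) _).1
    ((mfderivWithin_eq_chartPush (uniqueDiffOn_Icc hab) h.1 hm ht τ.IsFutureTimelike).1 (h.2 t ht))

theorem IsTimelikeArc.chron {γ : ℝ → M} {a b : ℝ} (h : τ.IsTimelikeArc γ a b) (hab : a < b) :
    τ.Chron (γ a) (γ b) :=
  .single ⟨γ, a, b, hab, h, rfl, rfl⟩

/-- A curve that is future-directed timelike in a chart connects chronologically related points. -/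
theorem chron_of_chart_curve {p : M} {c c' : ℝ → EuclideanSpace ℝ (Fin n)} {a b : ℝ} (hab : a < b)
    (hc : ContDiffOn ℝ 1 c (Icc a b))
    (hc' : ∀ t ∈ Icc a b, HasDerivWithinAt c (c' t) (Icc a b) t)
    (hm : MapsTo c (Icc a b) (extChartAt (𝓡 n) p).target)
    (ht : ∀ t ∈ Icc a b, g.chartForm p (c t) (c' t) (c' t) < 0 ∧
      g.chartForm p (c t) (τ.chartField p (c t)) (c' t) < 0) :
    τ.Chron ((extChartAt (𝓡 n) p).symm (c a)) ((extChartAt (𝓡 n) p).symm (c b)) := by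
  refine IsTimelikeArc.chron (γ := (extChartAt (𝓡 n) p).symm ∘ c)
    ⟨(contMDiffOn_extChartAt_symm p).comp hc.contMDiffOn hm, fun t h ↦ ?_⟩ hab
  rw [mfderivWithin_extChartAt_symm_comp (uniqueDiffOn_Icc hab) (hc.differentiableOn one_ne_zero)
    hm h, (hc' t h).derivWithin (uniqueDiffOn_Icc hab t h)]
  exact (isFutureTimelike_chartPush_iff τ (hm h) _).2 (ht t h)

/-! ### Openness of chronological futures and pasts, and their closures -/

/-- Near a point, segments in the chart in almost the same direction as a given future-directed
timelike vector are future-directed timelike. -/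
theorem exists_chron_of_segment (hr : 2 ≤ r) {p : M} {v : EuclideanSpace ℝ (Fin n)}
    (hv : g.chartForm p (extChartAt (𝓡 n) p p) v v < 0 ∧
      g.chartForm p (extChartAt (𝓡 n) p p) (τ.chartField p (extChartAt (𝓡 n) p p)) v < 0) :
    ∃ ρ > 0, ∀ x ∈ Metric.ball (extChartAt (𝓡 n) p p) ρ,
      ∀ y ∈ Metric.ball (extChartAt (𝓡 n) p p) ρ, ∀ s : ℝ, 0 < s → s⁻¹ • (y - x) ∈ Metric.ball v ρ →
        τ.Chron ((extChartAt (𝓡 n) p).symm x) ((extChartAt (𝓡 n) p).symm y) := by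
  obtain ⟨ρ, hρ, hball⟩ := exists_ball_timelike (extChartAt_target_mem_nhds p)
    (g.contDiffAt_chartForm hr p).continuousAt (τ.continuousAt_chartField p) hv
  refine ⟨ρ, hρ, fun x hx y hy s hs hxy ↦ ?_⟩
  have hmem : ∀ t ∈ Icc 0 s, x + t • s⁻¹ • (y - x) ∈ Metric.ball (extChartAt (𝓡 n) p p) ρ := by
    intro t ht
    rw [smul_smul, ← div_eq_mul_inv]
    exact (convex_ball _ ρ).add_smul_sub_mem hx hy
      ⟨div_nonneg ht.1 hs.le, (div_le_one hs).2 ht.2⟩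
  have hc : ContDiffOn ℝ 1 (fun t : ℝ ↦ x + t • s⁻¹ • (y - x)) (Icc 0 s) := by fun_prop
  have hc' : ∀ t ∈ Icc 0 s, HasDerivWithinAt (fun t : ℝ ↦ x + t • s⁻¹ • (y - x))
      (s⁻¹ • (y - x)) (Icc 0 s) t := fun t _ ↦ by
    simpa using (((hasDerivWithinAt_id t (Icc 0 s)).smul_const (s⁻¹ • (y - x))).const_add x)
  have := chron_of_chart_curve (τ := τ) hs hc hc' (fun t ht ↦ (hball _ (hmem t ht) _ hxy).1)
    (fun t ht ↦ (hball _ (hmem t ht) _ hxy).2)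
  have h0 : x + (0 : ℝ) • s⁻¹ • (y - x) = x := by simp
  have h1 : x + s • s⁻¹ • (y - x) = y := by simp [smul_smul, hs.ne']
  rwa [h0, h1] at this

theorem chartForm_chartField_neg (p : M) :
    g.chartForm p (extChartAt (𝓡 n) p p) (τ.chartField p (extChartAt (𝓡 n) p p))
      (τ.chartField p (extChartAt (𝓡 n) p p)) < 0 := by
  rw [g.chartForm_apply (mem_extChartAt_target p),
    τ.chartPush_chartField (mem_extChartAt_target p)]
  exact τ.timelike _

/-- Short chart segments from `x` in the direction of the time orientation are timelike and shrink
to `x`. -/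
theorem mem_closure_chronFuture_self (hr : 2 ≤ r) (x : M) : x ∈ closure (τ.chronFuture x) := by
  obtain ⟨ρ, hρ, h⟩ := exists_chron_of_segment hr
    ⟨chartForm_chartField_neg (τ := τ) x, chartForm_chartField_neg x⟩
  set z := extChartAt (𝓡 n) x x
  set v := τ.chartField x z
  have hlim : Filter.Tendsto (fun s : ℝ ↦ z + s • v) (𝓝[>] 0) (𝓝 z) := by
    have : Continuous (fun s : ℝ ↦ z + s • v) := by fun_prop
    simpa using (this.tendsto 0).mono_left nhdsWithin_le_nhds
  have hlim' := (continuousAt_extChartAt_symm (I := 𝓡 n) x).tendsto.comp hlim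
  rw [(extChartAt (𝓡 n) x).left_inv (mem_extChartAt_source x)] at hlim'
  refine mem_closure_of_tendsto hlim' ?_
  filter_upwards [hlim.eventually (Metric.ball_mem_nhds z hρ), self_mem_nhdsWithin] with s hs hs0
  have := h z (Metric.mem_ball_self hρ) _ hs s hs0 (by
    simpa [smul_smul, (mem_Ioi.1 hs0).ne'] using hρ)
  rwa [(extChartAt (𝓡 n) x).left_inv (mem_extChartAt_source x)] at this

theorem mem_closure_chronPast_self (hr : 2 ≤ r) (x : M) : x ∈ closure (τ.chronPast x) := by
  obtain ⟨ρ, hρ, h⟩ := exists_chron_of_segment hr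
    ⟨chartForm_chartField_neg (τ := τ) x, chartForm_chartField_neg x⟩
  set z := extChartAt (𝓡 n) x x
  set v := τ.chartField x z
  have hlim : Filter.Tendsto (fun s : ℝ ↦ z - s • v) (𝓝[>] 0) (𝓝 z) := by
    have : Continuous (fun s : ℝ ↦ z - s • v) := by fun_prop
    simpa using (this.tendsto 0).mono_left nhdsWithin_le_nhds
  have hlim' := (continuousAt_extChartAt_symm (I := 𝓡 n) x).tendsto.comp hlim
  rw [(extChartAt (𝓡 n) x).left_inv (mem_extChartAt_source x)] at hlim'
  refine mem_closure_of_tendsto hlim' ?_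
  filter_upwards [hlim.eventually (Metric.ball_mem_nhds z hρ), self_mem_nhdsWithin] with s hs hs0
  have := h _ hs z (Metric.mem_ball_self hρ) s hs0 (by
    simpa [smul_smul, (mem_Ioi.1 hs0).ne'] using hρ)
  rwa [(extChartAt (𝓡 n) x).left_inv (mem_extChartAt_source x)] at this

/-- The difference quotient of the last piece of the arc is close to the final velocity. With that
piece fixed, moving its endpoint slightly keeps the chord timelike, so all points near `γ b` are
reached. -/
theorem IsTimelikeArc.chronFuture_mem_nhds (hr : 2 ≤ r) {γ : ℝ → M} {a b : ℝ} (hab : a < b)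
    (h : τ.IsTimelikeArc γ a b) : τ.chronFuture (γ a) ∈ 𝓝 (γ b) := by
  set φ := extChartAt (𝓡 n) (γ b)
  obtain ⟨t₁, ht₁, hm⟩ := exists_Icc_left_of_eventually hab
    ((h.1.continuousOn b (right_mem_Icc.2 hab.le)).eventually
      (extChartAt_source_mem_nhds (I := 𝓡 n) (γ b)))
  have h1 := h.mono ht₁.1 ht₁.2 le_rfl
  have hb : b ∈ Icc t₁ b := right_mem_Icc.2 ht₁.2.le
  obtain ⟨ρ, hρ, hseg⟩ := exists_chron_of_segment hr (h1.chart ht₁.2 hm hb)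
  have hd := (((contDiffOn_extChartAt_comp h1.1 hm).differentiableOn one_ne_zero) b
    hb).hasDerivWithinAt
  set v := derivWithin (φ ∘ γ) (Icc t₁ b) b
  have hslope := (hasDerivWithinAt_iff_tendsto_slope.1 hd).eventually (Metric.ball_mem_nhds v hρ)
  have hcont := (hd.continuousWithinAt.mono (sdiff_subset (t := {b}))).eventually
    (Metric.ball_mem_nhds _ hρ)
  rw [Icc_sdiff_right, nhdsWithin_Ico_eq_nhdsLT ht₁.2] at hslope hcont
  obtain ⟨t, ⟨hs, hc⟩, ht⟩ := ((hslope.and hcont).and (Ioo_mem_nhdsLT ht₁.2)).exists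
  have hs' : (b - t)⁻¹ • (φ (γ b) - φ (γ t)) ∈ Metric.ball v ρ := by
    rw [slope_comm, slope_def_module] at hs
    exact hs
  have hφc : ContinuousAt φ (γ b) := continuousAt_extChartAt (γ b)
  have k1 := hφc.eventually (Metric.ball_mem_nhds _ hρ)
  have k2 := ((hφc.sub continuousAt_const).const_smul (b - t)⁻¹).eventually
    (Metric.isOpen_ball.mem_nhds hs')
  filter_upwards [k1, k2, extChartAt_source_mem_nhds (I := 𝓡 n) (γ b)] with y y1 y2 y3
  have hγ := hseg _ hc _ y1 (b - t) (by linarith [ht.2]) y2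
  rw [φ.left_inv y3, Function.comp_apply, φ.left_inv (hm t (Ioo_subset_Icc_self ht))] at hγ
  exact (h.mono le_rfl (ht₁.1.trans_lt ht.1) ht.2.le).chron (ht₁.1.trans_lt ht.1) |>.trans hγ

theorem IsTimelikeArc.chronPast_mem_nhds (hr : 2 ≤ r) {γ : ℝ → M} {a b : ℝ} (hab : a < b)
    (h : τ.IsTimelikeArc γ a b) : τ.chronPast (γ b) ∈ 𝓝 (γ a) := by
  set φ := extChartAt (𝓡 n) (γ a)
  obtain ⟨t₁, ht₁, -, hm⟩ := exists_Icc_right_of_eventually hab (lt_add_one a)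
    ((h.1.continuousOn a (left_mem_Icc.2 hab.le)).eventually
      (extChartAt_source_mem_nhds (I := 𝓡 n) (γ a)))
  have h1 := h.mono le_rfl ht₁.1 ht₁.2
  have ha : a ∈ Icc a t₁ := left_mem_Icc.2 ht₁.1.le
  obtain ⟨ρ, hρ, hseg⟩ := exists_chron_of_segment hr (h1.chart ht₁.1 hm ha)
  have hd := (((contDiffOn_extChartAt_comp h1.1 hm).differentiableOn one_ne_zero) a
    ha).hasDerivWithinAt
  set v := derivWithin (φ ∘ γ) (Icc a t₁) a
  have hslope := (hasDerivWithinAt_iff_tendsto_slope.1 hd).eventually (Metric.ball_mem_nhds v hρ)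
  have hcont := (hd.continuousWithinAt.mono (sdiff_subset (t := {a}))).eventually
    (Metric.ball_mem_nhds _ hρ)
  rw [Icc_sdiff_left, nhdsWithin_Ioc_eq_nhdsGT ht₁.1] at hslope hcont
  obtain ⟨t, ⟨hs, hc⟩, ht⟩ := ((hslope.and hcont).and (Ioo_mem_nhdsGT ht₁.1)).exists
  have hs' : (t - a)⁻¹ • (φ (γ t) - φ (γ a)) ∈ Metric.ball v ρ := by
    rw [slope_def_module] at hs
    exact hs
  have hφc : ContinuousAt φ (γ a) := continuousAt_extChartAt (γ a)
  have k1 := hφc.eventually (Metric.ball_mem_nhds _ hρ)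
  have k2 := ((continuousAt_const.sub hφc).const_smul (t - a)⁻¹).eventually
    (Metric.isOpen_ball.mem_nhds hs')
  filter_upwards [k1, k2, extChartAt_source_mem_nhds (I := 𝓡 n) (γ a)] with y y1 y2 y3
  have hγ := hseg _ y1 _ hc (t - a) (by linarith [ht.1]) y2
  rw [φ.left_inv y3, Function.comp_apply, φ.left_inv (hm t (Ioo_subset_Icc_self ht))] at hγ
  exact hγ.trans ((h.mono ht.1.le (ht.2.trans_le ht₁.2) le_rfl).chron (ht.2.trans_le ht₁.2))

theorem isOpen_chronFuture (hr : 2 ≤ r) (x : M) : IsOpen (τ.chronFuture x) := by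
  rw [isOpen_iff_mem_nhds]
  intro y hy
  rcases Relation.TransGen.tail'_iff.1 hy with ⟨w, hxw, γ, a, b, hab, h, rfl, rfl⟩
  refine Filter.mem_of_superset (h.chronFuture_mem_nhds hr hab) fun y hy ↦ ?_
  exact Relation.TransGen.trans_right hxw hy

theorem isOpen_chronPast (hr : 2 ≤ r) (x : M) : IsOpen (τ.chronPast x) := by
  rw [isOpen_iff_mem_nhds]
  intro y hy
  rcases Relation.TransGen.head'_iff.1 hy with ⟨w, ⟨γ, a, b, hab, h, rfl, rfl⟩, hwx⟩
  refine Filter.mem_of_superset (h.chronPast_mem_nhds hr hab) fun y hy ↦ ?_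
  exact Relation.TransGen.trans_left hy hwx

/-- If `z ∈ I⁺(y)`, the open set `I⁻(z)` is a neighbourhood of `y` and so meets `I⁺(x)`. Inclusions
compose, which makes closure membership transitive. -/
theorem mem_closure_chronFuture_iff (hr : 2 ≤ r) {x y : M} :
    y ∈ closure (τ.chronFuture x) ↔ τ.chronFuture y ⊆ τ.chronFuture x := by
  refine ⟨fun h z hz ↦ ?_, fun h ↦ closure_mono h (mem_closure_chronFuture_self hr y)⟩
  obtain ⟨w, hwz, hxw⟩ := mem_closure_iff.1 h _ (isOpen_chronPast hr z) hz
  exact Relation.TransGen.trans hxw hwz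

theorem mem_closure_chronPast_iff (hr : 2 ≤ r) {x y : M} :
    x ∈ closure (τ.chronPast y) ↔ τ.chronPast x ⊆ τ.chronPast y := by
  refine ⟨fun h z hz ↦ ?_, fun h ↦ closure_mono h (mem_closure_chronPast_self hr x)⟩
  obtain ⟨w, hzw, hwy⟩ := mem_closure_iff.1 h _ (isOpen_chronFuture hr z) hz
  exact Relation.TransGen.trans hzw hwy

/-! ### From causal arcs to inclusions of futures -/

/-- The local step of a continuous induction, hence the arbitrary bound `u`. As `t₁` does not depend
on `ε`, the endpoints of the tilted timelike curves tend to `γ t₁` as `ε → 0`. -/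
theorem IsCausalArc.exists_mem_closure_chronFuture (hr : 2 ≤ r) {γ : ℝ → M} {a b u : ℝ}
    (hab : a < b) (h : τ.IsCausalArc γ a b) (hu : a < u) :
    ∃ t ∈ Ioc a u, γ t ∈ closure (τ.chronFuture (γ a)) := by
  set φ := extChartAt (𝓡 n) (γ a) with hφ
  obtain ⟨b', hb', -, hm⟩ := exists_Icc_right_of_eventually hab (lt_add_one a)
    ((h.1.continuousOn a (left_mem_Icc.2 hab.le)).eventually
      (extChartAt_source_mem_nhds (I := 𝓡 n) (γ a)))
  have h1 := h.mono le_rfl hb'.1 hb'.2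
  have hab' := hb'.1
  have ha : a ∈ Icc a b' := left_mem_Icc.2 hab'.le
  have hc := contDiffOn_extChartAt_comp h1.1 hm
  have hd := hc.differentiableOn one_ne_zero
  obtain ⟨t₁, ht₁, htu, hε⟩ := eventually_timelike_perturbation (c := φ ∘ γ)
    (c' := derivWithin (φ ∘ γ) (Icc a b')) hab' hu
    (extChartAt_target_mem_nhds (γ a)) (g.contDiffAt_chartForm hr (γ a))
    (τ.continuousAt_chartField (γ a))
    (fun z hz v w ↦ by rw [g.chartForm_apply hz, g.chartForm_apply hz, g.symm])
    (hc.continuousOn a ha) (hc.continuousOn_derivWithin (uniqueDiffOn_Icc hab') le_rfl a ha)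
    (fun t ht ↦ (h1.chart hab' hm ht).1) (h1.chart hab' hm ha).2 (chartForm_chartField_neg _)
  refine ⟨t₁, ⟨ht₁.1, htu⟩, ?_⟩
  set T := τ.chartField (γ a) ((φ ∘ γ) a)
  have hsub : Icc a t₁ ⊆ Icc a b' := Icc_subset_Icc_right ht₁.2
  have hγt : γ t₁ ∈ φ.source := hm t₁ (hsub (right_mem_Icc.2 ht₁.1.le))
  have hlim : Filter.Tendsto (fun ε : ℝ ↦ φ (γ t₁) + (ε * (t₁ - a)) • T) (𝓝[>] 0)
      (𝓝 (φ (γ t₁))) := by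
    have : Continuous (fun ε : ℝ ↦ φ (γ t₁) + (ε * (t₁ - a)) • T) := by fun_prop
    simpa using (this.tendsto 0).mono_left nhdsWithin_le_nhds
  have hlim' := (continuousAt_extChartAt_symm' (I := 𝓡 n) hγt).tendsto.comp hlim
  rw [φ.left_inv hγt] at hlim'
  refine mem_closure_of_tendsto hlim' ?_
  filter_upwards [hε] with ε hε
  have := chron_of_chart_curve (τ := τ) (p := γ a)
    (c := fun t ↦ (φ ∘ γ) t + (ε * (t - a)) • T)
    (c' := fun t ↦ derivWithin (φ ∘ γ) (Icc a b') t + ε • T) ht₁.1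
    ((hc.mono hsub).add (by fun_prop))
    (fun t ht ↦ ((hd t (hsub ht)).hasDerivWithinAt.mono hsub).add (by
      simpa using (((hasDerivWithinAt_id t (Icc a t₁)).sub_const a).const_mul ε).smul_const T))
    (fun t ht ↦ (hε t ht).1) (fun t ht ↦ (hε t ht).2)
  have hφa : φ.symm (φ (γ a)) = γ a := φ.left_inv (mem_extChartAt_source (γ a))
  -- The tilt `ε(t - a)T` vanishes at `t = a`, so the timelike curve still starts at `γ a`.
  simp only [Function.comp_apply, sub_self, mul_zero, zero_smul, add_zero] at this
  rwa [← hφ, hφa] at this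

/-- The parameters whose points lie in `closure I⁺(γ a)` form a closed set containing `a`; the local
step, restarted at any of them before `b`, goes further. -/
theorem IsCausalArc.mem_closure_chronFuture (hr : 2 ≤ r) {γ : ℝ → M} {a b : ℝ}
    (hab : a < b) (h : τ.IsCausalArc γ a b) : γ b ∈ closure (τ.chronFuture (γ a)) := by
  have hclosed : IsClosed (γ ⁻¹' closure (τ.chronFuture (γ a)) ∩ Icc a b) := by
    rw [inter_comm]
    exact h.1.continuousOn.preimage_isClosed_of_isClosed isClosed_Icc isClosed_closure
  refine hclosed.Icc_subset_of_forall_exists_gt (mem_closure_chronFuture_self hr (γ a))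
    (fun t ht u hu ↦ ?_) (right_mem_Icc.2 hab.le)
  obtain ⟨s, hs, hγs⟩ :=
    (h.mono ht.2.1 ht.2.2 le_rfl).exists_mem_closure_chronFuture hr ht.2.2 hu
  refine ⟨s, ?_, hs⟩
  have h1 := (mem_closure_chronFuture_iff hr).1 ht.1
  exact closure_mono h1 hγs

theorem Causal.chronFuture_subset (hr : 2 ≤ r) {x y : M} (h : τ.Causal x y) :
    τ.chronFuture y ⊆ τ.chronFuture x := by
  induction h with
  | refl => rfl
  | tail _ hbc ih =>
    obtain ⟨γ, a, b, hab, h, rfl, rfl⟩ := hbc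
    exact ((mem_closure_chronFuture_iff hr).1 (h.mem_closure_chronFuture hr hab)).trans ih

theorem Chron.causal {x y : M} (h : τ.Chron x y) : τ.Causal x y :=
  Relation.ReflTransGen.mono
    (fun _ _ ⟨γ, a, b, hab, h, hx, hy⟩ ↦ ⟨γ, a, b, hab, h.isCausalArc, hx, hy⟩) _ _
    (Relation.TransGen.to_reflTransGen h)

/-! ### Comparison with the closure of the causal relation -/

theorem Df_subset_A : τ.Df ⊆ τ.A := fun p hp ↦
  map_mem_closure (f := fun y ↦ (p.1, y)) (by fun_prop) hp fun _ hy ↦ Chron.causal hy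

theorem Dp_subset_A : τ.Dp ⊆ τ.A := fun p hp ↦
  map_mem_closure (f := fun x ↦ (x, p.2)) (by fun_prop) hp fun _ hx ↦ Chron.causal hx

/-- Points on either side of a pair in the closure of the causal relation are chronologically
related. -/
theorem chron_of_mem_A (hr : 2 ≤ r) {x y z w : M} (h : (x, y) ∈ τ.A) (hz : τ.Chron z x)
    (hw : τ.Chron y w) : τ.Chron z w := by
  -- `I⁺(z) × I⁻(w)` is a neighbourhood of `(x, y)`, so it contains a causally related pair, giving
  -- `z ≪ x' ≤ y' ≪ w`.
  obtain ⟨⟨x', y'⟩, ⟨hx', hy'⟩, hJ⟩ := mem_closure_iff.1 h _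
    ((isOpen_chronFuture hr z).prod (isOpen_chronPast hr w)) ⟨hz, hw⟩
  exact Relation.TransGen.trans hx' (Causal.chronFuture_subset hr hJ hy')

/-- Reflectivity is applied to `x` and `w ∈ I⁺(y)` rather than to `x` and `y`, because `I⁻(x) ⊆
I⁻(w)` is available before `I⁻(x) ⊆ I⁻(y)` is known. Closedness then recovers `y`. -/
theorem A_subset_Df (hr : 2 ≤ r) (h : τ.IsFutureReflecting) : τ.A ⊆ τ.Df := by
  rintro ⟨x, y⟩ hxy
  refine closure_minimal (fun w hw ↦ ?_) isClosed_closure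
    (mem_closure_chronFuture_self (τ := τ) hr y)
  exact (mem_closure_chronFuture_iff hr).2 (h x w fun z hz ↦ chron_of_mem_A hr hxy hz hw)

theorem isReflecting_iff_D_eq_A (hr : 2 ≤ r) : τ.IsReflecting ↔ τ.D = τ.A := by
  constructor
  · rintro ⟨hf, hp⟩
    have hDA : τ.D ⊆ τ.A := fun q hq ↦ Dp_subset_A hq.1
    refine Subset.antisymm hDA fun q hq ↦ ?_
    have hDf : q.2 ∈ closure (τ.chronFuture q.1) := A_subset_Df hr hf hq
    -- Past reflectivity turns membership in `Df` into membership in `Dp`, so no time-dual of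
    -- `A_subset_Df` is needed.
    exact ⟨(mem_closure_chronPast_iff hr).2
      (hp q.1 q.2 ((mem_closure_chronFuture_iff hr).1 hDf)), hDf⟩
  · intro hD
    refine ⟨fun x y h ↦ ?_, fun x y h ↦ ?_⟩
    · have : (x, y) ∈ τ.D := by
        rw [hD]
        exact Dp_subset_A (show x ∈ closure (τ.chronPast y) from
          (mem_closure_chronPast_iff hr).2 h)
      exact (mem_closure_chronFuture_iff hr).1 this.2
    · have : (x, y) ∈ τ.D := by
        rw [hD]
        exact Df_subset_A (show y ∈ closure (τ.chronFuture x) from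
          (mem_closure_chronFuture_iff hr).2 h)
      exact (mem_closure_chronPast_iff hr).1 this.1

end TimeOrientation

end Spacetime

theorem mainTheorem6 {n : ℕ} (hn : 2 ≤ n) {r : ℕ∞} (hr : 3 ≤ r)
    {M : Type*} [TopologicalSpace M] [T2Space M] [SecondCountableTopology M] [ConnectedSpace M]
    [ChartedSpace (EuclideanSpace ℝ (Fin n)) M]
    [IsManifold (𝓡 n) 1 M] [IsManifold (𝓡 n) (r : WithTop ℕ∞) M]
    (g : Spacetime.LorentzianMetric n r M) (τ : Spacetime.TimeOrientation g) :
    τ.IsReflecting ↔ τ.D = τ.A := by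
  exact Spacetime.TimeOrientation.isReflecting_iff_D_eq_A (le_trans (by norm_num) hr)
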